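/- Suppose $n$ traders $1,\dots,n$ own one indivisible good each (trader $k$ owns good $k$), and each trader $k$ ranks all $n$ goods by a permutation $p_k=p_{k1}\dots p_{kn}$ of $\{1,\dots,n\}$, most preferred good first. An allocation is a permutation $g_1\dots g_n$ of $\{1,\dots,n\}$ (trader $k$ gets $g_k$). It is *stable* if, for every nonempty set $C$ of traders and every permutation $h$ of $C$ such that each $k\in C$ likes $h_k$ at least as much as $g_k$, one has $h_k=g_k$ for all $k\in C$. For every $p=(p_1,\dots,p_n)$ there is exactly one stable allocation. *Uniform hashing* with priorities $\pi$ (a permutation of $\{1,\dots,n\}$) instead gives the traders, in the order $\pi(1),\pi(2),\dots,\pi(n)$, the first good in their list that has not been taken yet; this too determines exactly one allocation. Let $p_1,\dots,p_n$ be independent and uniformly random, let $g$ be the stable allocation (or, alternatively, the allocation produced by uniform hashing with any fixed priorities), and let $r_k$ be the rank of $g_k$ in the list of trader $k$, that is, $g_k=p_{kr_k}$. Write $H_n=\sum_{k=1}^n 1/k$ and $H_n^{(2)}=\sum_{k=1}^n 1/k^2$. Then for all $n$ $$E(r_1^2+\cdots+r_n^2)=(n+1)(n-H_n)+n,$$ $$E\bigl((r_1+\cdots+r_n)^2\bigr)=(n+1)^2\bigl(H_n^2-H_n^{(2)}\bigr)-(n+1)(2n+1)H_n+n(3n+4).$$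 As $n\to\infty$, the expected empirical variance of the ranks (the expected value of $\frac1n\sum_k(r_k-\bar r)^2$, where $\bar r=\frac1n\sum_k r_k$) satisfies $$E\left(\frac1n\sum_{k=1}^n(r_k-\bar r)^2\right)=E\left(\frac{r_1^2+\cdots+r_n^2}{n}\right)-E\left(\Bigl(\frac{r_1+\cdots+r_n}{n}\Bigr)^2\right)=n+O\bigl((\log n)^2\bigr).$$ The variance of the rank sum is $$\operatorname{Var}(r_1+\cdots+r_n)=E\bigl((r_1+\cdots+r_n)^2\bigr)-\bigl(E(r_1+\cdots+r_n)\bigr)^2=2n(n+2)-(n+1)^2H_n^{(2)}-(n+1)H_n=\Bigl(2-\frac{\pi^2}{6}\Bigr)n^2+O(n\log n),$$ where the exact formula holds for all $n$ and the estimate as $n\to\infty$; consequently the standard deviation of $r_1+\cdots+r_n$ is $O(n)$. -/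

import Mathlib

open scoped BigOperators Asymptotics

namespace Allocation

/-- Preferences of `n` traders for `n` goods: `p k j` is the item in position `j` (counted from `0`)
of the list of trader `k`, who owns good `k`. -/
abbrev Profile (n : ℕ) : Type := Fin n → Equiv.Perm (Fin n)

/-- An allocation: trader `k` gets good `g k`. -/
abbrev Alloc (n : ℕ) : Type := Equiv.Perm (Fin n)

variable {n : ℕ}

/-- The (1-based) rank of good `i` in the list of trader `k`. -/
def rankOf (p : Profile n) (k i : Fin n) : ℕ := ((p k).symm i : ℕ) + 1

/-- Trader `k` likes good `i` at least as much as good `j`. -/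
def WeaklyPrefers (p : Profile n) (k i j : Fin n) : Prop := rankOf p k i ≤ rankOf p k j

/-- Stability of `g`: if a coalition `C` redistributes the goods of its own members by `h` in such a
way that no member likes the result less than `g`, then `h` agrees with `g` on `C`. -/
def IsStable (p : Profile n) (g : Alloc n) : Prop :=
  ∀ C : Finset (Fin n), C.Nonempty → ∀ h : C ≃ C,
    (∀ k : C, WeaklyPrefers p k (h k) (g k)) → ∀ k : C, (h k : Fin n) = g k

/-- `g` is the outcome of uniform hashing with priorities `π`: the `k`-th trader `π k` in order of
priority gets the first item of the list `p (π k)` not taken by `π 0, …, π (k - 1)`. -/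
def IsUniformHashing (π : Equiv.Perm (Fin n)) (p : Profile n) (g : Alloc n) : Prop :=
  ∀ k : Fin n, IsLeast {j : Fin n | ∀ i < k, p (π k) j ≠ g (π i)} ((p (π k)).symm (g (π k)))

/-- The final rank `r k` of trader `k`, as a real number: `g k` is item number `r k` in the list of
trader `k`. -/
def finalRank (p : Profile n) (g : Alloc n) (k : Fin n) : ℝ := (rankOf p k (g k) : ℝ)

/-- Sum of the final ranks. -/
noncomputable def rankSum (p : Profile n) (g : Alloc n) : ℝ := ∑ k, finalRank p g k

/-- Sum of the squares of the final ranks. -/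
noncomputable def rankSqSum (p : Profile n) (g : Alloc n) : ℝ := ∑ k, finalRank p g k ^ 2

/-- Empirical variance of the `n` final ranks: the mean square deviation from their mean. -/
noncomputable def rankEmpVar (p : Profile n) (g : Alloc n) : ℝ :=
  (∑ k, (finalRank p g k - rankSum p g / n) ^ 2) / n

/-- Expectation when the `n` preference lists are independent and uniformly random, that is, when
all `n! ^ n` profiles are equally likely. -/
noncomputable def E (X : Profile n → ℝ) : ℝ :=
  (∑ p : Profile n, X p) / (n.factorial : ℝ) ^ n

/-- Variance with respect to the same distribution. -/
noncomputable def Var (X : Profile n → ℝ) : ℝ := E fun p => (X p - E X) ^ 2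

/-- The harmonic number `H_n = 1 + 1 / 2 + ⋯ + 1 / n`. -/
noncomputable def H (n : ℕ) : ℝ := ∑ k ∈ Finset.Icc 1 n, 1 / (k : ℝ)

/-- The second-order harmonic number `1 + 1 / 2 ^ 2 + ⋯ + 1 / n ^ 2`. -/
noncomputable def H₂ (n : ℕ) : ℝ := ∑ k ∈ Finset.Icc 1 n, 1 / (k : ℝ) ^ 2

end Allocation

/-! For a profile and an allocation `g`, let `k` envy `l` if `k` prefers `g l` to `g k`. Stability
of `g` is equivalent to the existence of a potential that is constant on the cycles of `g⁻¹` and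
decreases along envy (`isStable_of_hasPotential`, `IsStable.hasPotential`). Hashing with priorities
`π` yields `g` exactly when everybody envied comes earlier in `π` (`isUniformHashing_iff`), that is,
when `π` is a topological ordering of the envy relation.

Renaming the goods by `σ` preserves ranks and envy but turns `g⁻¹` into `g⁻¹ * σ`. So for fixed `p`
and `g`, the renamings that make `g` stable are counted by the permutations compatible with a
potential, and these are equinumerous with the topological orderings (`card_hasPotential_eq`).
Summing over `p` and `g`, stable ranks are distributed as hashing ranks with random priorities
(`sum_isStable_eq`).

For fixed priorities the hashing ranks are independent, the one at step `k` being the position of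
the first item outside a `k`-set in a random list (`hashingSum_prod`, `searchSum_id`,
`searchSum_sq`). The moments do not depend on `π`, so they hold for stable allocation too. Harmonic
sums give the formulas, and elementary bounds on `H` and `H₂` the asymptotics. -/

namespace Allocation

open Finset Function Equiv

variable {n : ℕ}

/-! ### Stability, trading cycles and potentials -/

theorem exists_iterate_mem_periodicPts {α : Type*} [Finite α] (f : α → α) (x : α) :
    ∃ i, f^[i] x ∈ periodicPts f := by
  obtain ⟨i, j, hne, h⟩ := Finite.exists_ne_map_eq_of_infinite (fun i : ℕ => f^[i] x)
  wlog hij : i < j generalizing i j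
  · exact this j i hne.symm h.symm (by omega)
  refine ⟨i, mk_mem_periodicPts (n := j - i) (by omega) ?_⟩
  change f^[j - i] (f^[i] x) = f^[i] x
  rw [← iterate_add_apply, Nat.sub_add_cancel hij.le]
  exact h.symm

/-- If trader `k` likes `f k` at least as much as the stable `g k` whenever `k` is periodic
under `f`, then `f` and `g` agree on the periodic points of `f`. -/
theorem IsStable.eq_of_mem_periodicPts {p : Profile n} {g : Alloc n} (hg : IsStable p g)
    (f : Fin n → Fin n) (hf : ∀ k ∈ periodicPts f, WeaklyPrefers p k (f k) (g k)) :
    ∀ k ∈ periodicPts f, f k = g k := by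
  classical
  intro k hk
  have hb := bijOn_periodicPts f
  -- `f` permutes its periodic points, so it is an admissible redistribution within this coalition.
  let C : Finset (Fin n) := univ.filter (· ∈ periodicPts f)
  have hC : ∀ x, x ∈ C ↔ x ∈ periodicPts f := fun x => by simp [C]
  let h : C → C := fun x => ⟨f x, (hC _).2 (hb.mapsTo ((hC _).1 x.2))⟩
  have hinj : Injective h := by
    intro x y hxy
    exact Subtype.ext (hb.injOn ((hC _).1 x.2) ((hC _).1 y.2) (congrArg Subtype.val hxy))
  have hbij : Bijective h := Finite.injective_iff_bijective.1 hinj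
  exact hg C ⟨k, (hC k).2 hk⟩ (Equiv.ofBijective h hbij)
    (fun x => hf x ((hC _).1 x.2)) ⟨k, (hC k).2 hk⟩

/-- Let every trader point to the better of the two goods. On the cycles of this map `m`, both
stable allocations agree with `m`. As `g` and `g'` are injective, no trader outside the cycles can
point into one; but every orbit ends in a cycle, so all traders lie on cycles. -/
theorem IsStable.unique {p : Profile n} {g g' : Alloc n} (hg : IsStable p g)
    (hg' : IsStable p g') : g = g' := by
  classical
  let m : Fin n → Fin n := fun k => if rankOf p k (g k) ≤ rankOf p k (g' k) then g k else g' k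
  have h1 : ∀ k ∈ periodicPts m, m k = g k := hg.eq_of_mem_periodicPts m fun k _ => by
    simp only [m, WeaklyPrefers]; split_ifs with h <;> omega
  have h2 : ∀ k ∈ periodicPts m, m k = g' k := hg'.eq_of_mem_periodicPts m fun k _ => by
    simp only [m, WeaklyPrefers]; split_ifs with h <;> omega
  have hb := bijOn_periodicPts m
  have hback : ∀ k, m k ∈ periodicPts m → k ∈ periodicPts m := by
    intro k hk
    obtain ⟨c, hc, hck⟩ := hb.surjOn hk
    by_cases h : rankOf p k (g k) ≤ rankOf p k (g' k)
    · have : m k = g k := if_pos h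
      have : k = c := g.injective (by rw [← this, ← hck, h1 c hc])
      rwa [this]
    · have : m k = g' k := if_neg h
      have : k = c := g'.injective (by rw [← this, ← hck, h2 c hc])
      rwa [this]
  have hall : ∀ i k, m^[i] k ∈ periodicPts m → k ∈ periodicPts m := by
    intro i
    induction i with
    | zero => intro k hk; exact hk
    | succ i ih => intro k hk; exact hback k (ih (m k) hk)
  ext k
  obtain ⟨i, hi⟩ := exists_iterate_mem_periodicPts m k
  have hk := hall i k hi
  rw [← h1 k hk, ← h2 k hk]

/-- Under the allocation `g`, trader `k` prefers the good of trader `l` to their own. -/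
def Envies (p : Profile n) (g : Alloc n) (k l : Fin n) : Prop :=
  rankOf p k (g l) < rankOf p k (g k)

/-- There is a potential, constant on the cycles of `ρ`, that decreases along `D`. -/
def HasPotential (D : Fin n → Fin n → Prop) (ρ : Equiv.Perm (Fin n)) : Prop :=
  ∃ φ : Fin n → ℕ, (∀ x, φ (ρ x) = φ x) ∧ ∀ k l, D k l → φ l < φ k

theorem rankOf_injective (p : Profile n) (k : Fin n) : Injective (rankOf p k) := by
  intro i j h
  simpa [rankOf, Fin.val_inj] using h

/-- A trader whose good changes gets one held by somebody they envy, on whose cycle the potential is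
lower. Hence the potential never increases along `h`; as `h` permutes `C`, its sum is preserved, so
it never drops either. -/
theorem isStable_of_hasPotential {p : Profile n} {g : Alloc n}
    (h : HasPotential (Envies p g) g⁻¹) : IsStable p g := by
  obtain ⟨φ, hφ, hD⟩ := h
  intro C _ h hw
  have hlt : ∀ k : C, (h k : Fin n) ≠ g k → φ (h k) < φ k := by
    intro k hne
    rw [← hφ]
    apply hD
    have : g (g⁻¹ (h k)) = h k := by simp
    rw [Envies, this]
    exact lt_of_le_of_ne (hw k) fun e => hne (rankOf_injective p k e)
  have hle : ∀ k : C, φ (h k) ≤ φ k := by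
    intro k
    by_cases hne : (h k : Fin n) = g k
    · rw [← hφ, hne]; simp
    · exact (hlt k hne).le
  have hsum : ∑ k : C, φ (h k) = ∑ k : C, φ k := Equiv.sum_comp h (fun k : C => φ k)
  have heq := (sum_eq_sum_iff_of_le (fun k (_ : k ∈ univ) => hle k)).1 hsum
  intro k
  by_contra hne
  exact (hlt k hne).ne (heq k (mem_univ k))

/-- Induction in the manner of top trading cycles: within a `g`-invariant set, each trader points to
a good they envy, or else to their own `g k`. Stability forces agreement with `g` on the resulting
cycles, so traders there envy nobody in the set. These get potential `0`, and the remaining traders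
are treated recursively. -/
theorem IsStable.hasPotential {p : Profile n} {g : Alloc n} (hg : IsStable p g) :
    HasPotential (Envies p g) g⁻¹ := by
  classical
  have key : ∀ (N : ℕ) (S : Finset (Fin n)), S.card ≤ N → (∀ x ∈ S, g x ∈ S) →
      ∃ φ : Fin n → ℕ, (∀ x ∈ S, φ (g x) = φ x) ∧
        ∀ k ∈ S, ∀ l ∈ S, Envies p g k l → φ l < φ k := by
    intro N
    induction N with
    | zero =>
      intro S hS _
      have : S = ∅ := by simpa using hS
      exact ⟨0, by simp [this]⟩
    | succ N ih =>
      intro S hS hinv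
      rcases S.eq_empty_or_nonempty with rfl | ⟨s, hs⟩
      · exact ⟨0, by simp⟩
      let f : Fin n → Fin n := fun k =>
        if h : k ∈ S ∧ ∃ l ∈ S, Envies p g k l then g h.2.choose else g k
      have hf : ∀ k, k ∈ S → (∃ l ∈ S, Envies p g k l) → ∃ l ∈ S, Envies p g k l ∧ f k = g l := by
        intro k hk hl
        have h : k ∈ S ∧ ∃ l ∈ S, Envies p g k l := ⟨hk, hl⟩
        exact ⟨h.2.choose, h.2.choose_spec.1, h.2.choose_spec.2, dif_pos h⟩
      have hf' : ∀ k, ¬(k ∈ S ∧ ∃ l ∈ S, Envies p g k l) → f k = g k := fun k h => dif_neg h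
      have hfS : ∀ k ∈ S, f k ∈ S := by
        intro k hk
        by_cases hl : ∃ l ∈ S, Envies p g k l
        · obtain ⟨l, hl, -, e⟩ := hf k hk hl
          rw [e]; exact hinv l hl
        · rw [hf' k fun h => hl h.2]; exact hinv k hk
      have hfg : ∀ k ∈ periodicPts f, f k = g k := by
        refine hg.eq_of_mem_periodicPts f fun k _ => ?_
        by_cases h : k ∈ S ∧ ∃ l ∈ S, Envies p g k l
        · obtain ⟨l, -, hl, e⟩ := hf k h.1 h.2
          rw [e]; exact hl.le
        · rw [hf' k h]; exact le_rfl
      have hb := bijOn_periodicPts f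
      have hno : ∀ k ∈ S, k ∈ periodicPts f → ∀ l ∈ S, ¬ Envies p g k l := by
        intro k hk hkp l hl hkl
        obtain ⟨l', -, h', e⟩ := hf k hk ⟨l, hl, hkl⟩
        rw [hfg k hkp] at e
        rw [Envies, e] at h'
        exact lt_irrefl _ h'
      have hgP : ∀ k, g k ∈ periodicPts f ↔ k ∈ periodicPts f := by
        intro k
        constructor
        · intro hk
          obtain ⟨c, hc, hck⟩ := hb.surjOn hk
          rw [hfg c hc] at hck
          rwa [← g.injective hck]
        · intro hk
          rw [← hfg k hk]; exact hb.mapsTo hk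
      have hSi : ∀ i, f^[i] s ∈ S := by
        intro i
        induction i with
        | zero => exact hs
        | succ i ihi => rw [iterate_succ_apply']; exact hfS _ ihi
      obtain ⟨i, hi⟩ := exists_iterate_mem_periodicPts f s
      have hcard : (S.filter (· ∉ periodicPts f)).card ≤ N := by
        have : (S.filter (· ∉ periodicPts f)).card < S.card :=
          card_lt_card (filter_ssubset.2 ⟨_, hSi i, by simpa using hi⟩)
        omega
      -- The periodic points form a union of cycles of `g`, so what remains is again invariant.
      obtain ⟨φ, h1, h2⟩ := ih (S.filter (· ∉ periodicPts f)) hcard (by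
        intro x hx
        rw [mem_filter] at hx ⊢
        exact ⟨hinv x hx.1, fun h => hx.2 ((hgP x).1 h)⟩)
      refine ⟨fun x => if x ∈ periodicPts f then 0 else φ x + 1, ?_, ?_⟩
      · intro x hx
        by_cases h : x ∈ periodicPts f
        · simp [h, hgP]
        · simp [h, hgP, h1 x (mem_filter.2 ⟨hx, h⟩)]
      · intro k hk l hl hkl
        have hkp : k ∉ periodicPts f := fun h => hno k hk h l hl hkl
        by_cases h : l ∈ periodicPts f
        · simp [h, hkp]
        · simpa [h, hkp] using
            h2 k (mem_filter.2 ⟨hk, hkp⟩) l (mem_filter.2 ⟨hl, h⟩) hkl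
  obtain ⟨φ, h1, h2⟩ := key _ univ le_rfl (by simp)
  refine ⟨φ, fun x => ?_, fun k l => h2 k (mem_univ _) l (mem_univ _)⟩
  rw [← h1 (g⁻¹ x) (mem_univ _)]; simp

/-! ### Renaming the goods -/

/-- The profile obtained from `p` by renaming every good `i` to `σ⁻¹ i`. -/
def relabel (σ : Equiv.Perm (Fin n)) (p : Profile n) : Profile n := fun k => σ⁻¹ * p k

theorem rankOf_relabel (σ : Equiv.Perm (Fin n)) (p : Profile n) (k i : Fin n) :
    rankOf (relabel σ p) k i = rankOf p k (σ i) := by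
  simp [rankOf, relabel, Equiv.Perm.mul_def, Equiv.Perm.inv_def]

theorem isStable_relabel_iff (σ : Equiv.Perm (Fin n)) (p : Profile n) (g : Alloc n) :
    IsStable (relabel σ p) (σ⁻¹ * g) ↔ HasPotential (Envies p g) (g⁻¹ * σ) := by
  have h : Envies (relabel σ p) (σ⁻¹ * g) = Envies p g := by
    funext k l
    simp [Envies, rankOf_relabel]
  have h' : (σ⁻¹ * g)⁻¹ = g⁻¹ * σ := by group
  rw [← h, ← h']
  exact ⟨IsStable.hasPotential, isStable_of_hasPotential⟩

/-! ### Invariant parts of sets of vertices -/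

/-- The largest subset of `M` that is mapped into itself by `ρ`. -/
noncomputable def invariantPart {α : Type*} [Fintype α] (M : Set α) (ρ : Perm α) : Finset α :=
  open Classical in univ.filter fun x => ∀ i : ℕ, ρ^[i] x ∈ M

section invariantPart

variable {α : Type*} [Fintype α] {M : Set α} {ρ : Perm α}

theorem mem_invariantPart {x : α} : x ∈ invariantPart M ρ ↔ ∀ i : ℕ, ρ^[i] x ∈ M := by
  simp [invariantPart]

theorem mem_of_mem_invariantPart {x : α} (h : x ∈ invariantPart M ρ) : x ∈ M :=
  mem_invariantPart.1 h 0

theorem apply_mem_invariantPart {x : α} (h : x ∈ invariantPart M ρ) :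
    ρ x ∈ invariantPart M ρ :=
  mem_invariantPart.2 fun i => mem_invariantPart.1 h (i + 1)

theorem subset_invariantPart {T : Finset α} (h : ∀ x ∈ T, x ∈ M) (h' : ∀ x ∈ T, ρ x ∈ T) :
    T ⊆ invariantPart M ρ := by
  intro x hx
  have : ∀ i, ρ^[i] x ∈ T := by
    intro i
    induction i with
    | zero => exact hx
    | succ i ih => rw [iterate_succ_apply']; exact h' _ ih
  exact mem_invariantPart.2 fun i => h _ (this i)

/-- An injective map of a finite set into itself is onto. -/
theorem apply_mem_invariantPart_iff {x : α} :
    ρ x ∈ invariantPart M ρ ↔ x ∈ invariantPart M ρ := by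
  refine ⟨fun h => ?_, apply_mem_invariantPart⟩
  have hU : (invariantPart M ρ).map ρ.toEmbedding = invariantPart M ρ :=
    eq_of_subset_of_card_le (map_subset_iff_subset_preimage.2 fun y hy => by
      simpa using apply_mem_invariantPart hy) (by simp)
  rw [← hU] at h
  simpa using h

/-- The swap preserves the invariant part, which therefore stays invariant under the product and can
only grow. Multiplying by the same swap again gives the reverse inclusion. -/
theorem invariantPart_mul_swap [DecidableEq α] {m v : α} (hm : m ∈ invariantPart M ρ)
    (hv : v ∈ invariantPart M ρ) : invariantPart M (ρ * swap m v) = invariantPart M ρ := by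
  have step : ∀ {τ : Perm α}, m ∈ invariantPart M τ → v ∈ invariantPart M τ →
      invariantPart M τ ⊆ invariantPart M (τ * swap m v) := by
    intro τ hm hv
    refine subset_invariantPart (fun x => mem_of_mem_invariantPart) fun x hx => ?_
    rw [Perm.mul_apply]
    apply apply_mem_invariantPart
    rw [swap_apply_def]
    split_ifs <;> assumption
  have h1 := step hm hv
  refine Subset.antisymm ?_ h1
  have h2 := step (h1 hm) (h1 hv)
  rwa [mul_assoc, swap_mul_self, mul_one] at h2

end invariantPart

/-! ### Inserting a sink into a cycle -/

/-- The embedding of `Fin n` in `Fin (n + 1)` with range `{v}ᶜ` used by `Perm.decomposeFin`. -/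
def avoid (v : Fin (n + 1)) (i : Fin n) : Fin (n + 1) := swap 0 v i.succ

theorem avoid_injective (v : Fin (n + 1)) : Injective (avoid v) := by
  intro i j h
  simpa [avoid] using h

theorem avoid_ne (v : Fin (n + 1)) (i : Fin n) : avoid v i ≠ v := by
  intro h
  have : i.succ = 0 := by
    rw [← (swap (0 : Fin (n + 1)) v).apply_eq_iff_eq, swap_apply_left]; exact h
  exact Fin.succ_ne_zero i this

theorem exists_avoid_eq {v x : Fin (n + 1)} (h : x ≠ v) : ∃ i, avoid v i = x := by
  have : swap 0 v x ≠ 0 := by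
    intro h'
    apply h
    rw [← (swap (0 : Fin (n + 1)) v).apply_eq_iff_eq, h', swap_apply_right]
  obtain ⟨i, hi⟩ := Fin.exists_succ_eq.2 this
  exact ⟨i, by rw [avoid, hi, swap_apply_self]⟩

theorem decomposeFin_symm_succ (v : Fin (n + 1)) (e : Perm (Fin n)) (i : Fin n) :
    Perm.decomposeFin.symm (v, e) i.succ = avoid v (e i) :=
  Perm.decomposeFin_symm_apply_succ e v i

/-- The permutation that fixes `v` and acts as `e` on `{v}ᶜ`. -/
def extendFix (v : Fin (n + 1)) (e : Perm (Fin n)) : Perm (Fin (n + 1)) :=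
  swap 0 v * Perm.decomposeFin.symm (0, e) * swap 0 v

theorem extendFix_self (v : Fin (n + 1)) (e : Perm (Fin n)) : extendFix v e v = v := by
  simp [extendFix]

theorem extendFix_avoid (v : Fin (n + 1)) (e : Perm (Fin n)) (i : Fin n) :
    extendFix v e (avoid v i) = avoid v (e i) := by
  simp [extendFix, avoid]

theorem extendFix_injective (v : Fin (n + 1)) : Injective (extendFix v) := by
  intro e e' h
  ext i : 1
  apply avoid_injective v
  rw [← extendFix_avoid, ← extendFix_avoid, h]

theorem exists_extendFix_eq {v : Fin (n + 1)} {τ : Perm (Fin (n + 1))} (h : τ v = v) :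
    ∃ e, extendFix v e = τ := by
  obtain ⟨⟨w, e⟩, he⟩ := Perm.decomposeFin.symm.surjective (swap 0 v * τ * swap 0 v)
  have hw : w = 0 := by
    have := congrArg (fun f : Perm (Fin (n + 1)) => f 0) he
    simpa [h] using this
  refine ⟨e, ?_⟩
  rw [extendFix, ← hw, he, hw]
  simp [mul_assoc]

/-- The vertices without outgoing edges. -/
def sinks (D : Fin n → Fin n → Prop) : Set (Fin n) := {x | ∀ l, ¬ D x l}

/-- For `m ≠ v`, multiplying by the swap inserts `v` into its cycle right after `m`. This alters the
permutation only inside `U`, an invariant set of sinks both before and after. Edges start outside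
`U`, so a potential may be reset to `0` on `U` and raised by one elsewhere. -/
theorem hasPotential_insert_iff {D : Fin (n + 1) → Fin (n + 1) → Prop} {v m : Fin (n + 1)}
    {e : Perm (Fin n)} (hv : v ∈ sinks D)
    (hm : m ∈ invariantPart (sinks D) (extendFix v e)) :
    HasPotential D (extendFix v e * swap m v) ↔
      HasPotential (fun i j => D (avoid v i) (avoid v j)) e := by
  classical
  set U := invariantPart (sinks D) (extendFix v e) with hU
  have hvU : v ∈ U := subset_invariantPart (T := {v}) (by simpa using hv)
    (by simp [extendFix_self]) (by simp)
  have hUτ : invariantPart (sinks D) (extendFix v e * swap m v) = U :=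
    invariantPart_mul_swap hm hvU
  have hsink : ∀ k l, D k l → k ∉ U := fun k l hkl hk => mem_of_mem_invariantPart hk l hkl
  constructor
  · rintro ⟨φ, h1, h2⟩
    refine ⟨fun i => if avoid v i ∈ U then 0 else φ (avoid v i) + 1, fun i => ?_, fun i j hij => ?_⟩
    · simp only [← extendFix_avoid v e i, hU, apply_mem_invariantPart_iff]
      split_ifs with h
      · rfl
      · have hi : avoid v i ≠ m := by rintro hi; exact h (hi ▸ hm)
        have := h1 (avoid v i)
        rw [Perm.mul_apply, swap_apply_of_ne_of_ne hi (avoid_ne v i)] at this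
        rw [this]
    · have := hsink _ _ hij
      have h3 := h2 _ _ hij
      simp only [this, if_false]
      split_ifs <;> omega
  · rintro ⟨φ', h1, h2⟩
    obtain ⟨φ, rfl⟩ := (avoid_injective v).surjective_comp_right φ'
    refine ⟨fun x => if x ∈ U then 0 else φ x + 1, fun x => ?_, fun k l hkl => ?_⟩
    · have hx : (extendFix v e * swap m v) x ∈ U ↔ x ∈ U := by
        rw [← hUτ, apply_mem_invariantPart_iff]
      simp only [hx]
      split_ifs with h
      · rfl
      · have hxm : x ≠ m := by rintro rfl; exact h hm
        have hxv : x ≠ v := by rintro rfl; exact h hvU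
        obtain ⟨i, rfl⟩ := exists_avoid_eq hxv
        rw [Perm.mul_apply, swap_apply_of_ne_of_ne hxm hxv, extendFix_avoid]
        exact congrArg (· + 1) (h1 i)
    · have hk := hsink _ _ hkl
      simp only [hk, if_false]
      split_ifs with hl
      · omega
      · have hkv : k ≠ v := by rintro rfl; exact hk hvU
        have hlv : l ≠ v := by rintro rfl; exact hl hvU
        obtain ⟨i, rfl⟩ := exists_avoid_eq hkv
        obtain ⟨j, rfl⟩ := exists_avoid_eq hlv
        have := h2 i j hkl
        simp only [comp_apply] at this
        omega

/-- On the cycle of a minimum of the potential every vertex is a minimum, hence a sink. -/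
theorem HasPotential.invariantPart_nonempty {D : Fin (n + 1) → Fin (n + 1) → Prop}
    {ρ : Perm (Fin (n + 1))} (h : HasPotential D ρ) : (invariantPart (sinks D) ρ).Nonempty := by
  obtain ⟨φ, h1, h2⟩ := h
  obtain ⟨x, hx⟩ := Finite.exists_min φ
  refine ⟨x, mem_invariantPart.2 fun i l hl => ?_⟩
  have : ∀ i : ℕ, φ (ρ^[i] x) = φ x := by
    intro i
    induction i with
    | zero => rfl
    | succ i ih => rw [iterate_succ_apply', h1, ih]
  have h3 := h2 _ _ hl
  rw [this] at h3
  exact absurd (hx l) (by omega)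

/-! ### Counting permutations by topological orderings -/

open Classical in
-- The bijection inserts the sink `v` after the largest element `m` of the invariant part. Insertion
-- does not change that part, so the result `ρ` determines `m`, then `v = ρ m`, then `e`.
theorem card_hasPotential_succ (D : Fin (n + 1) → Fin (n + 1) → Prop) :
    (univ.filter fun x : Fin (n + 1) × Perm (Fin n) => x.1 ∈ sinks D ∧
      HasPotential (fun i j => D (avoid x.1 i) (avoid x.1 j)) x.2).card =
    (univ.filter fun ρ => HasPotential D ρ).card := by
  let top : Fin (n + 1) × Perm (Fin n) → Fin (n + 1) := fun x =>
    (invariantPart (sinks D) (extendFix x.1 x.2)).sup id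
  have hv : ∀ x : Fin (n + 1) × Perm (Fin n), x.1 ∈ sinks D →
      x.1 ∈ invariantPart (sinks D) (extendFix x.1 x.2) := fun x hx =>
    subset_invariantPart (T := {x.1}) (by simpa using hx) (by simp [extendFix_self]) (by simp)
  have htop : ∀ x : Fin (n + 1) × Perm (Fin n), x.1 ∈ sinks D →
      top x ∈ invariantPart (sinks D) (extendFix x.1 x.2) := by
    intro x hx
    obtain ⟨y, hy, e⟩ := exists_mem_eq_sup (invariantPart (sinks D) (extendFix x.1 x.2))
      ⟨_, hv x hx⟩ id
    simp only [top, e]; exact hy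
  refine card_bij (fun x _ => extendFix x.1 x.2 * swap (top x) x.1) ?_ ?_ ?_
  · intro x hx
    rw [mem_filter] at hx ⊢
    exact ⟨mem_univ _, (hasPotential_insert_iff hx.2.1 (htop x hx.2.1)).2 hx.2.2⟩
  · intro x hx y hy hxy
    rw [mem_filter] at hx hy
    have hU : ∀ z : Fin (n + 1) × Perm (Fin n), z.1 ∈ sinks D →
        top z = (invariantPart (sinks D) (extendFix z.1 z.2 * swap (top z) z.1)).sup id := by
      intro z hz
      rw [invariantPart_mul_swap (htop z hz) (hv z hz)]
    have htt : top x = top y := by rw [hU x hx.2.1, hU y hy.2.1, hxy]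
    have hap : ∀ z : Fin (n + 1) × Perm (Fin n),
        (extendFix z.1 z.2 * swap (top z) z.1) (top z) = z.1 := by
      intro z; simp [extendFix_self]
    have h1 : x.1 = y.1 := by rw [← hap x, ← hap y, hxy, htt]
    have h2 : extendFix x.1 x.2 = extendFix y.1 y.2 := by
      rw [htt, h1] at hxy
      have := mul_right_cancel hxy
      rwa [h1]
    rw [h1] at h2
    exact Prod.ext h1 (extendFix_injective _ h2)
  · intro ρ hρ
    rw [mem_filter] at hρ
    set U := invariantPart (sinks D) ρ with hUdef
    obtain ⟨m, hm, e⟩ := exists_mem_eq_sup U hρ.2.invariantPart_nonempty id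
    have hvU : ρ m ∈ U := apply_mem_invariantPart hm
    obtain ⟨τ, hτ⟩ : ∃ τ, extendFix (ρ m) τ = ρ * swap m (ρ m) :=
      exists_extendFix_eq (by simp)
    have hvs : ρ m ∈ sinks D := mem_of_mem_invariantPart hvU
    have ht : top (ρ m, τ) = m := by
      simp only [top, hτ]
      rw [invariantPart_mul_swap hm hvU, ← hUdef, e]; rfl
    have hback : extendFix (ρ m) τ * swap (top (ρ m, τ)) (ρ m) = ρ := by
      rw [ht, hτ, mul_assoc, swap_mul_self, mul_one]
    refine ⟨(ρ m, τ), ?_, hback⟩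
    rw [mem_filter]
    refine ⟨mem_univ _, hvs, ?_⟩
    rw [← hasPotential_insert_iff hvs (htop (ρ m, τ) hvs)]
    rw [show extendFix (ρ m, τ).1 (ρ m, τ).2 * swap (top (ρ m, τ)) (ρ m, τ).1 = ρ from hback]
    exact hρ.2

/-- Edges point to earlier positions, so the first vertex must be a sink, and the others are ordered
independently of it. This is the same recursion as in `card_hasPotential_succ`. -/
theorem decomposeFin_symm_order_iff (D : Fin (n + 1) → Fin (n + 1) → Prop) (v : Fin (n + 1))
    (e : Perm (Fin n)) :
    (∀ i j, D (Perm.decomposeFin.symm (v, e) i) (Perm.decomposeFin.symm (v, e) j) → j < i) ↔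
      v ∈ sinks D ∧ ∀ i j, D (avoid v (e i)) (avoid v (e j)) → j < i := by
  constructor
  · intro h
    refine ⟨fun l hl => ?_, fun i j hij => ?_⟩
    · obtain ⟨j, rfl⟩ := (Perm.decomposeFin.symm (v, e)).surjective l
      exact absurd (h 0 j (by simpa using hl)) (by simp)
    · have := h i.succ j.succ (by simpa only [decomposeFin_symm_succ] using hij)
      simpa using this
  · rintro ⟨h1, h2⟩ i j
    refine Fin.cases ?_ (fun i => ?_) i
    · intro h
      rw [Perm.decomposeFin_symm_apply_zero] at h
      exact absurd h (h1 _)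
    · refine Fin.cases (fun _ => Fin.succ_pos i) (fun j => ?_) j
      rw [decomposeFin_symm_succ, decomposeFin_symm_succ]
      intro h
      simpa using h2 i j h

open Classical in
/-- The permutations `ρ` for which some potential is constant on the cycles of `ρ` and decreases
along `D` are as many as the topological orderings of `D`. -/
theorem card_hasPotential_eq : ∀ (n : ℕ) (D : Fin n → Fin n → Prop),
    (univ.filter fun ρ => HasPotential D ρ).card =
      (univ.filter fun π : Perm (Fin n) => ∀ i j, D (π i) (π j) → j < i).card
  | 0, D => by
    congr 1
    ext ρ
    simp only [mem_filter, mem_univ, true_and]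
    exact ⟨fun _ i => i.elim0, fun _ => ⟨0, fun i => i.elim0, fun i => i.elim0⟩⟩
  | n + 1, D => by
    rw [← card_hasPotential_succ, card_filter, card_filter, ← Perm.decomposeFin.symm.sum_comp,
      Fintype.sum_prod_type, Fintype.sum_prod_type]
    refine sum_congr rfl fun v _ => ?_
    simp only [decomposeFin_symm_order_iff]
    by_cases hv : v ∈ sinks D
    · simp only [hv, true_and]
      rw [← card_filter, ← card_filter]
      exact card_hasPotential_eq n fun i j => D (avoid v i) (avoid v j)
    · simp [hv]

/-! ### Uniform hashing -/

/-- A trader misses a preferred good exactly when its holder chose earlier. -/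
theorem isUniformHashing_iff (π : Perm (Fin n)) (p : Profile n) (g : Alloc n) :
    IsUniformHashing π p g ↔ ∀ i j, Envies p g (π i) (π j) → j < i := by
  constructor
  · intro h k l hkl
    by_contra hlk
    have hmem : (p (π k)).symm (g (π l)) ∈ {j : Fin n | ∀ i < k, p (π k) j ≠ g (π i)} := by
      intro i hi e
      rw [apply_symm_apply] at e
      have : l = i := π.injective (g.injective e)
      exact hlk (this ▸ hi)
    have h1 : (p (π k)).symm (g (π k)) ≤ (p (π k)).symm (g (π l)) := (h k).2 hmem
    rw [Fin.le_def] at h1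
    simp only [Envies, rankOf] at hkl
    omega
  · intro h k
    refine ⟨fun i hi e => ?_, fun j hj => ?_⟩
    · rw [apply_symm_apply] at e
      exact hi.ne' (π.injective (g.injective e))
    · by_contra hlt
      rw [not_le, Fin.lt_def] at hlt
      let l := π.symm (g.symm (p (π k) j))
      have hl : g (π l) = p (π k) j := by simp [l]
      have : Envies p g (π k) (π l) := by
        simp only [Envies, rankOf, hl, symm_apply_apply]
        omega
      exact hj l (h k l this) hl.symm

theorem IsUniformHashing.unique {π : Perm (Fin n)} {p : Profile n} {g g' : Alloc n}
    (hg : IsUniformHashing π p g) (hg' : IsUniformHashing π p g') : g = g' := by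
  have key : ∀ k, g (π k) = g' (π k) := by
    intro k
    induction k using WellFoundedLT.induction with
    | ind k ih =>
      have h1 := hg k
      have h2 := hg' k
      have hset : {j : Fin n | ∀ i < k, p (π k) j ≠ g (π i)} =
          {j : Fin n | ∀ i < k, p (π k) j ≠ g' (π i)} := by
        ext j
        exact forall₂_congr fun i hi => by rw [ih i hi]
      rw [hset] at h1
      exact (p (π k)).symm.injective (h1.unique h2)
  ext x : 1
  simpa using key (π.symm x)

theorem exists_isUniformHashing (π : Perm (Fin n)) (p : Profile n) :
    ∃ g, IsUniformHashing π p g := by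
  classical
  -- `f i` is the good taken at step `i`; only its values at the first `m` steps matter.
  have key : ∀ m : ℕ, ∃ f : Fin n → Fin n, ∀ k : Fin n, (k : ℕ) < m →
      IsLeast {j : Fin n | ∀ i < k, p (π k) j ≠ f i} ((p (π k)).symm (f k)) := by
    intro m
    induction m with
    | zero => exact ⟨id, by simp⟩
    | succ m ih =>
      obtain ⟨f, hf⟩ := ih
      by_cases hm : m < n
      swap
      · exact ⟨f, fun k hk => hf k (by omega)⟩
      let x : Fin n := ⟨m, hm⟩
      let S : Finset (Fin n) := univ.filter fun j => ∀ i < x, p (π x) j ≠ f i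
      have hS : S.Nonempty := by
        have hcard : ((Iio x).image f).card < (univ : Finset (Fin n)).card := by
          refine card_image_le.trans_lt ?_
          simp [x, hm]
        obtain ⟨y, -, hy⟩ := exists_mem_notMem_of_card_lt_card hcard
        refine ⟨(p (π x)).symm y, mem_filter.2 ⟨mem_univ _, fun i hi e => hy ?_⟩⟩
        rw [apply_symm_apply] at e
        exact mem_image.2 ⟨i, mem_Iio.2 hi, e.symm⟩
      refine ⟨update f x (p (π x) (S.min' hS)), fun k hk => ?_⟩
      have hset : {j : Fin n | ∀ i < k, p (π k) j ≠ update f x (p (π x) (S.min' hS)) i} =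
          {j : Fin n | ∀ i < k, p (π k) j ≠ f i} := by
        ext j
        refine forall₂_congr fun i hi => ?_
        rw [update_of_ne]
        rintro rfl
        rw [Fin.lt_def] at hi
        simp only [x] at hi
        omega
      rw [hset]
      by_cases hkx : k = x
      · subst hkx
        have := isLeast_min' S hS
        simpa [S] using this
      · rw [update_of_ne hkx]
        refine hf k ?_
        have : (k : ℕ) ≠ m := fun h => hkx (Fin.ext h)
        omega
  obtain ⟨f, hf⟩ := key n
  have hinj : Injective f := by
    have hlt : ∀ i k, i < k → f k ≠ f i := fun i k hik => by
      simpa using (hf k k.2).1 i hik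
    intro i k h
    rcases lt_trichotomy i k with h' | h' | h'
    · exact absurd h.symm (hlt i k h')
    · exact h'
    · exact absurd h (hlt k i h')
  refine ⟨π.symm.trans (Equiv.ofBijective f (Finite.injective_iff_bijective.1 hinj)), fun k => ?_⟩
  simpa using hf k k.2

theorem existsUnique_isUniformHashing (π : Perm (Fin n)) (p : Profile n) :
    ∃! g, IsUniformHashing π p g :=
  existsUnique_of_exists_of_unique (exists_isUniformHashing π p) fun _ _ => IsUniformHashing.unique

/-! ### Stable allocation compared with random priorities -/

open Classical in
theorem card_isStable_relabel (p : Profile n) (g : Alloc n) :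
    (univ.filter fun σ : Perm (Fin n) => IsStable (relabel σ p) (σ⁻¹ * g)).card =
      (univ.filter fun π : Perm (Fin n) => IsUniformHashing π p g).card := by
  simp only [isUniformHashing_iff]
  rw [← card_hasPotential_eq]
  refine card_equiv (Equiv.mulLeft g⁻¹) fun σ => ?_
  simp [isStable_relabel_iff]

open Classical in
theorem sum_ite_eq_of_existsUnique {α : Type*} [Fintype α] {P : α → Prop} {a : α}
    (h : ∃! x, P x) (ha : P a) (F : α → ℝ) : ∑ x, (if P x then F x else 0) = F a := by
  rw [Fintype.sum_eq_single a fun x hx => if_neg fun hP => hx (h.unique hP ha), if_pos ha]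

/-- Existence follows by counting: each `σ` admits at most one `g`, yet the total number of pairs
equals that of pairs of priorities and hashing outcomes, which is `n!`. So every `σ` admits one, in
particular `σ = 1`. -/
theorem existsUnique_isStable (p : Profile n) : ∃! g, IsStable p g := by
  classical
  have hle : ∀ σ : Perm (Fin n), (univ.filter fun g => IsStable (relabel σ p) (σ⁻¹ * g)).card ≤ 1 :=
    fun σ => card_le_one.2 fun g hg g' hg' =>
      mul_left_cancel ((mem_filter.1 hg).2.unique (mem_filter.1 hg').2)
  have hsum : ∑ σ : Perm (Fin n), (univ.filter fun g => IsStable (relabel σ p) (σ⁻¹ * g)).card =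
      ∑ _σ : Perm (Fin n), 1 := by
    calc _ = ∑ g, (univ.filter fun σ : Perm (Fin n) => IsStable (relabel σ p) (σ⁻¹ * g)).card := by
          simp only [card_filter]; exact sum_comm
      _ = ∑ g, (univ.filter fun π : Perm (Fin n) => IsUniformHashing π p g).card :=
          sum_congr rfl fun g _ => card_isStable_relabel p g
      _ = ∑ π : Perm (Fin n), (univ.filter fun g => IsUniformHashing π p g).card := by
          simp only [card_filter]; exact sum_comm
      _ = _ := by
          refine sum_congr rfl fun π _ => ?_
          obtain ⟨g, hg, hu⟩ := existsUnique_isUniformHashing π p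
          exact card_eq_one.2 ⟨g, by ext x; simpa using ⟨hu x, fun h => h ▸ hg⟩⟩
  have h1 := (sum_eq_sum_iff_of_le fun σ (_ : σ ∈ univ) => hle σ).1 hsum 1 (mem_univ _)
  obtain ⟨g, hg⟩ := card_pos.1 (h1 ▸ Nat.one_pos)
  have hg' : IsStable (relabel 1 p) (1⁻¹ * g) := (mem_filter.1 hg).2
  have hp : relabel 1 p = p := by funext k; simp [relabel]
  have : IsStable p g := by simpa [hp] using hg'
  exact ⟨g, this, fun g' h => h.unique this⟩

theorem finalRank_relabel (σ : Perm (Fin n)) (p : Profile n) (g : Alloc n) :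
    finalRank (relabel σ p) (σ⁻¹ * g) = finalRank p g := by
  funext k
  simp [finalRank, rankOf_relabel]

open Classical in
/-- The ranks of the stable allocation are distributed as those of uniform hashing with random
priorities. -/
theorem sum_isStable_eq (F : (Fin n → ℝ) → ℝ) :
    n.factorial * ∑ p : Profile n, ∑ g, (if IsStable p g then F (finalRank p g) else 0) =
      ∑ π : Perm (Fin n), ∑ p : Profile n, ∑ g,
        (if IsUniformHashing π p g then F (finalRank p g) else 0) := by
  -- Renaming permutes the profiles and preserves ranks, so averaging over `σ` changes nothing.
  have hrel : ∀ σ : Perm (Fin n),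
      ∑ p : Profile n, ∑ g, (if IsStable p g then F (finalRank p g) else 0) =
      ∑ p : Profile n, ∑ g, (if IsStable (relabel σ p) (σ⁻¹ * g) then F (finalRank p g) else 0) := by
    intro σ
    have hb : Bijective (relabel σ : Profile n → Profile n) :=
      (Equiv.piCongrRight fun _ : Fin n => Equiv.mulLeft σ⁻¹).bijective
    rw [← hb.sum_comp]
    refine sum_congr rfl fun p _ => ?_
    rw [← Equiv.sum_comp (Equiv.mulLeft σ⁻¹)]
    refine sum_congr rfl fun g _ => ?_
    simp only [coe_mulLeft, finalRank_relabel]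
  calc _ = ∑ σ : Perm (Fin n), ∑ p : Profile n, ∑ g,
        (if IsStable (relabel σ p) (σ⁻¹ * g) then F (finalRank p g) else 0) := by
        rw [← sum_congr rfl fun σ _ => hrel σ]
        simp [Fintype.card_perm]
    _ = ∑ p : Profile n, ∑ g, ∑ σ : Perm (Fin n),
        (if IsStable (relabel σ p) (σ⁻¹ * g) then F (finalRank p g) else 0) := by
        rw [sum_comm]; exact sum_congr rfl fun p _ => sum_comm
    _ = ∑ p : Profile n, ∑ g, ∑ π : Perm (Fin n),
        (if IsUniformHashing π p g then F (finalRank p g) else 0) := by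
        refine sum_congr rfl fun p _ => sum_congr rfl fun g _ => ?_
        rw [← sum_filter, ← sum_filter, sum_const, sum_const, card_isStable_relabel]
    _ = _ := by
        symm; rw [sum_comm]; exact sum_congr rfl fun p _ => sum_comm

/-! ### Moments of a single search -/

/-- The sum of `f r` over the lists `q` in which `x` has rank `r` and is the first item that is
not in `S`. -/
noncomputable def searchSum (S : Finset (Fin n)) (x : Fin n) (f : ℕ → ℝ) : ℝ :=
  ∑ q : Perm (Fin n), if ∀ j < q.symm x, q j ∈ S then f (q.symm x + 1) else 0

theorem searchSum_add (S : Finset (Fin n)) (x : Fin n) (f f' : ℕ → ℝ) :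
    searchSum S x (fun r => f r + f' r) = searchSum S x f + searchSum S x f' := by
  simp only [searchSum, ← sum_add_distrib]
  refine sum_congr rfl fun q _ => ?_
  split_ifs <;> simp

theorem searchSum_const_mul (S : Finset (Fin n)) (x : Fin n) (c : ℝ) (f : ℕ → ℝ) :
    searchSum S x (fun r => c * f r) = c * searchSum S x f := by
  simp only [searchSum, mul_sum]
  refine sum_congr rfl fun q _ => ?_
  split_ifs <;> simp

/-- Condition on the first item: if it is `x`, the rank is `1`; if it lies in `S`, the search
continues in the rest of the list with one taken item fewer and the rank shifted by one; otherwise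
the list does not count. -/
theorem searchSum_succ_eq {S : Finset (Fin (n + 1))} {x : Fin (n + 1)} (hx : x ∉ S) {f : ℕ → ℝ}
    {c : ℝ} (hc : ∀ (T : Finset (Fin n)) (y : Fin n), y ∉ T → T.card + 1 = S.card →
      searchSum T y (fun r => f (r + 1)) = c) :
    searchSum S x f = n.factorial * f 1 + S.card * c := by
  classical
  have hterm : ∀ v : Fin (n + 1), ∑ e : Perm (Fin n),
      (if ∀ j < (Perm.decomposeFin.symm (v, e)).symm x, Perm.decomposeFin.symm (v, e) j ∈ S
        then f ((Perm.decomposeFin.symm (v, e)).symm x + 1) else 0) =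
      (if v = x then n.factorial * f 1 else 0) + (if v ∈ S then c else 0) := by
    intro v
    by_cases hvx : v = x
    · subst hvx
      have : ∀ e : Perm (Fin n), (Perm.decomposeFin.symm (v, e)).symm v = 0 := by
        intro e; rw [symm_apply_eq]; simp
      simp [this, hx, Fintype.card_perm]
    · obtain ⟨y, rfl⟩ := exists_avoid_eq (Ne.symm hvx)
      have hy : ∀ e : Perm (Fin n), (Perm.decomposeFin.symm (v, e)).symm (avoid v y) =
          (e.symm y).succ := by
        intro e; rw [symm_apply_eq, decomposeFin_symm_succ, apply_symm_apply]
      have hcond : ∀ e : Perm (Fin n), (∀ j < (e.symm y).succ,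
          Perm.decomposeFin.symm (v, e) j ∈ S) ↔
          v ∈ S ∧ ∀ j < e.symm y, e j ∈ univ.filter fun i => avoid v i ∈ S := by
        intro e
        simp only [Fin.forall_fin_succ, Fin.succ_pos, forall_const, Fin.succ_lt_succ_iff,
          decomposeFin_symm_succ, Perm.decomposeFin_symm_apply_zero, mem_filter, mem_univ, true_and]
      simp only [hy, hcond, if_neg hvx, zero_add, Fin.val_succ]
      by_cases hv : v ∈ S
      · simp only [hv, true_and, if_true]
        refine hc (univ.filter fun i => avoid v i ∈ S) y (by simpa using hx) ?_
        have : (univ.filter fun i => avoid v i ∈ S).map ⟨avoid v, avoid_injective v⟩ =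
            S.erase v := by
          ext z
          simp only [mem_map, mem_filter, mem_univ, true_and, Embedding.coeFn_mk, mem_erase]
          constructor
          · rintro ⟨i, hi, rfl⟩; exact ⟨avoid_ne v i, hi⟩
          · rintro ⟨hz, hzS⟩
            obtain ⟨i, rfl⟩ := exists_avoid_eq hz
            exact ⟨i, hzS, rfl⟩
        rw [← card_map ⟨avoid v, avoid_injective v⟩, this, card_erase_add_one hv]
      · simp [hv]
  rw [searchSum, ← Perm.decomposeFin.symm.sum_comp, Fintype.sum_prod_type,
    sum_congr rfl fun v _ => hterm v, sum_add_distrib]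
  simp

theorem card_lt_of_notMem {S : Finset (Fin n)} {x : Fin n} (hx : x ∉ S) : S.card < n := by
  simpa using card_lt_univ_of_notMem hx

theorem searchSum_one : ∀ {n : ℕ} {S : Finset (Fin n)} {x : Fin n}, x ∉ S →
    searchSum S x (fun _ => 1) = n.factorial / ((n : ℝ) - S.card)
  | 0, _, x, _ => x.elim0
  | n + 1, S, x, hx => by
    have hlt : (S.card : ℝ) < n + 1 := by exact_mod_cast card_lt_of_notMem hx
    rw [searchSum_succ_eq hx (c := n.factorial / ((n : ℝ) + 1 - S.card))]
    · have : (n : ℝ) + 1 - S.card ≠ 0 := by linarith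
      rw [Nat.factorial_succ]; push_cast; field_simp; ring
    · intro T y hy hT
      rw [searchSum_one hy, ← hT]; push_cast; ring

theorem searchSum_id : ∀ {n : ℕ} {S : Finset (Fin n)} {x : Fin n}, x ∉ S →
    searchSum S x (fun r => (r : ℝ)) =
      n.factorial / ((n : ℝ) - S.card) * ((n + 1) / (n - S.card + 1))
  | 0, _, x, _ => x.elim0
  | n + 1, S, x, hx => by
    have hlt : (S.card : ℝ) < n + 1 := by exact_mod_cast card_lt_of_notMem hx
    rw [searchSum_succ_eq hx (c := n.factorial / ((n : ℝ) + 1 - S.card) *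
      ((n + 1) / (n + 1 - S.card + 1)) + n.factorial / ((n : ℝ) + 1 - S.card))]
    · have h1 : (n : ℝ) + 1 - S.card ≠ 0 := by linarith
      have h2 : (n : ℝ) + 1 - S.card + 1 ≠ 0 := by linarith
      rw [Nat.factorial_succ]; push_cast; field_simp; ring
    · intro T y hy hT
      push_cast
      rw [searchSum_add, searchSum_id hy, searchSum_one hy, ← hT]; push_cast; ring

/-- The first fraction in the bracket is the mean of `r (r + 1)`, from which the mean of `r` is
subtracted. -/
theorem searchSum_sq : ∀ {n : ℕ} {S : Finset (Fin n)} {x : Fin n}, x ∉ S →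
    searchSum S x (fun r => (r : ℝ) ^ 2) =
      n.factorial / ((n : ℝ) - S.card) * (2 * (n + 1) * (n + 2) /
        ((n - S.card + 1) * (n - S.card + 2)) - (n + 1) / (n - S.card + 1))
  | 0, _, x, _ => x.elim0
  | n + 1, S, x, hx => by
    have hlt : (S.card : ℝ) < n + 1 := by exact_mod_cast card_lt_of_notMem hx
    rw [searchSum_succ_eq hx (c := n.factorial / ((n : ℝ) + 1 - S.card) * (2 * (n + 1) * (n + 2) /
        ((n + 1 - S.card + 1) * (n + 1 - S.card + 2)) - (n + 1) / (n + 1 - S.card + 1)) +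
      (2 * (n.factorial / ((n : ℝ) + 1 - S.card) *
      ((n + 1) / (n + 1 - S.card + 1))) + n.factorial / ((n : ℝ) + 1 - S.card)))]
    · have h1 : (n : ℝ) + 1 - S.card ≠ 0 := by linarith
      have h2 : (n : ℝ) + 1 - S.card + 1 ≠ 0 := by linarith
      have h3 : (n : ℝ) + 1 - S.card + 2 ≠ 0 := by linarith
      rw [Nat.factorial_succ]; push_cast; field_simp; ring
    · intro T y hy hT
      have : (fun r : ℕ => ((r + 1 : ℕ) : ℝ) ^ 2) = fun r : ℕ => (r : ℝ) ^ 2 + (2 * (r : ℝ) + 1) := by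
        funext r; push_cast; ring
      rw [this, searchSum_add, searchSum_add, searchSum_const_mul, searchSum_sq hy, searchSum_id hy,
        searchSum_one hy, ← hT]
      push_cast; ring

/-! ### Independence of the hashing ranks -/

open Classical in
/-- The sum of `F` over the final ranks of uniform hashing with priorities `π`, for all profiles. -/
noncomputable def hashingSum (π : Perm (Fin n)) (F : (Fin n → ℝ) → ℝ) : ℝ :=
  ∑ p : Profile n, ∑ g, if IsUniformHashing π p g then F (finalRank p g) else 0

theorem hashingSum_finset_sum (π : Perm (Fin n)) {ι : Type*} (s : Finset ι)
    (F : ι → (Fin n → ℝ) → ℝ) :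
    hashingSum π (fun r => ∑ i ∈ s, F i r) = ∑ i ∈ s, hashingSum π (F i) := by
  classical
  simp only [hashingSum]
  symm
  rw [sum_comm]
  refine sum_congr rfl fun p _ => ?_
  rw [sum_comm]
  refine sum_congr rfl fun g _ => ?_
  split_ifs <;> simp

/-- For fixed `g`, hashing yields `g` iff in each list all items before the trader's own good belong
to earlier traders. This is one condition per list, so the sum over profiles factorizes; the factors
depend only on the number of goods taken, so all `n!` allocations contribute equally. -/
theorem hashingSum_prod (π : Perm (Fin n)) (f : Fin n → ℝ → ℝ) (c : Fin n → ℝ)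
    (hc : ∀ (k : Fin n) (S : Finset (Fin n)) (x : Fin n), x ∉ S → S.card = k →
      searchSum S x (fun r => f k r) = c k) :
    hashingSum π (fun r => ∏ k, f k (r (π k))) = n.factorial * ∏ k, c k := by
  classical
  have hg : ∀ g : Alloc n, ∑ p : Profile n,
      (if IsUniformHashing π p g then ∏ k, f k (finalRank p g (π k)) else 0) = ∏ k, c k := by
    intro g
    let G : Fin n → Perm (Fin n) → ℝ := fun t q =>
      if ∀ j < q.symm (g t), q j ∈ (Iio (π.symm t)).image (fun i => g (π i)) then
        f (π.symm t) ((q.symm (g t) + 1 : ℕ) : ℝ) else 0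
    have hG : ∀ p : Profile n, (if IsUniformHashing π p g then
        ∏ k, f k (finalRank p g (π k)) else 0) = ∏ t, G t (p t) := by
      intro p
      have hiff : IsUniformHashing π p g ↔ ∀ t, ∀ j < (p t).symm (g t),
          p t j ∈ (Iio (π.symm t)).image (fun i => g (π i)) := by
        rw [isUniformHashing_iff]
        constructor
        · intro h t j hj
          refine mem_image.2 ⟨π.symm (g.symm (p t j)), mem_Iio.2 (h _ _ ?_), by simp⟩
          simp only [Envies, rankOf, apply_symm_apply, symm_apply_apply]
          rw [Fin.lt_def] at hj
          omega
        · intro h k l hkl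
          have := h (π k) ((p (π k)).symm (g (π l))) (by
            rw [Fin.lt_def]; simp only [Envies, rankOf] at hkl; omega)
          rw [apply_symm_apply, symm_apply_apply] at this
          obtain ⟨i, hi, e⟩ := mem_image.1 this
          have : i = l := π.injective (g.injective e)
          exact this ▸ mem_Iio.1 hi
      split_ifs with h
      · rw [← π.symm.prod_comp]
        refine prod_congr rfl fun t _ => ?_
        simp only [G]
        rw [if_pos (hiff.1 h t), apply_symm_apply]
        rfl
      · rw [hiff] at h
        obtain ⟨t, ht⟩ := not_forall.1 h
        exact (prod_eq_zero (mem_univ t) (if_neg ht)).symm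
    rw [sum_congr rfl fun p _ => hG p, ← Fintype.piFinset_univ, ← prod_univ_sum,
      ← Equiv.prod_comp π]
    refine prod_congr rfl fun k _ => ?_
    rw [← hc k ((Iio k).image fun i => g (π i)) (g (π k))]
    · simp only [G, searchSum, symm_apply_apply]
    · intro h
      obtain ⟨i, hi, e⟩ := mem_image.1 h
      exact (mem_Iio.1 hi).ne (π.injective (g.injective e))
    · exact (card_image_of_injective _ (g.injective.comp π.injective)).trans (by simp)
  rw [hashingSum, sum_comm, sum_congr rfl fun g _ => hg g]
  simp [Fintype.card_perm]

/-- The mean of the rank in the hashing step in which `k` goods have been taken. -/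
noncomputable def meanRank (n k : ℕ) : ℝ := (n + 1) / (n - k + 1)

/-- The second moment of the rank in the hashing step in which `k` goods have been taken. -/
noncomputable def meanSqRank (n k : ℕ) : ℝ :=
  2 * (n + 1) * (n + 2) / ((n - k + 1) * (n - k + 2)) - (n + 1) / (n - k + 1)

theorem hashingSum_prod_of_mean (π : Perm (Fin n)) (f : Fin n → ℝ → ℝ) (c : Fin n → ℝ)
    (hc : ∀ (k : Fin n) (S : Finset (Fin n)) (x : Fin n), x ∉ S → S.card = k →
      searchSum S x (fun r => f k r) = n.factorial / ((n : ℝ) - S.card) * c k) :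
    hashingSum π (fun r => ∏ k, f k (r (π k))) = (n.factorial : ℝ) ^ n * ∏ k, c k := by
  rw [hashingSum_prod π f (fun k => n.factorial / ((n : ℝ) - (k : ℕ)) * c k)
    (fun k S x hx hS => by rw [hc k S x hx hS, hS])]
  have hprod : ∏ k : Fin n, ((n : ℝ) - (k : ℕ)) = n.factorial := by
    rw [Fin.prod_univ_eq_prod_range (fun k => (n : ℝ) - k) n, ← Nat.descFactorial_self n,
      Nat.descFactorial_eq_prod_range, Nat.cast_prod]
    exact prod_congr rfl fun k hk => (Nat.cast_sub (mem_range.1 hk).le).symm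
  have hne : (n.factorial : ℝ) ≠ 0 := by positivity
  rw [prod_mul_distrib, prod_div_distrib, hprod, prod_const, card_univ, Fintype.card_fin]
  field_simp

theorem hashingSum_apply (π : Perm (Fin n)) (k : Fin n) :
    hashingSum π (fun r => r (π k)) = (n.factorial : ℝ) ^ n * meanRank n k := by
  have h := hashingSum_prod_of_mean π (fun i x => if i = k then x else 1)
    (fun i => if i = k then meanRank n k else 1) (by
      intro i S x hx hS
      split_ifs with h
      · rw [searchSum_id hx, meanRank, hS, h]
      · rw [searchSum_one hx, mul_one])
  simpa using h

theorem hashingSum_apply_sq (π : Perm (Fin n)) (k : Fin n) :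
    hashingSum π (fun r => r (π k) ^ 2) = (n.factorial : ℝ) ^ n * meanSqRank n k := by
  have h := hashingSum_prod_of_mean π (fun i x => if i = k then x ^ 2 else 1)
    (fun i => if i = k then meanSqRank n k else 1) (by
      intro i S x hx hS
      split_ifs with h
      · rw [searchSum_sq hx, meanSqRank, hS, h]
      · rw [searchSum_one hx, mul_one])
  simpa using h

theorem hashingSum_apply_mul (π : Perm (Fin n)) {k l : Fin n} (hkl : k ≠ l) :
    hashingSum π (fun r => r (π k) * r (π l)) =
      (n.factorial : ℝ) ^ n * (meanRank n k * meanRank n l) := by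
  have h := hashingSum_prod_of_mean π (fun i x => (if i = k then x else 1) * (if i = l then x else 1))
    (fun i => (if i = k then meanRank n k else 1) * (if i = l then meanRank n l else 1)) (by
      intro i S x hx hS
      by_cases hk : i = k
      · have hl : i ≠ l := fun h => hkl (hk.symm.trans h)
        simp only [hk, if_true, if_neg hkl, mul_one]
        rw [searchSum_id hx, meanRank, hS, hk]
      · by_cases hl : i = l
        · simp only [hl, if_true, if_neg hkl.symm, one_mul]
          rw [searchSum_id hx, meanRank, hS, hl]
        · simp only [hk, hl, if_false, mul_one]
          rw [searchSum_one hx])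
  simp only [prod_mul_distrib, prod_ite_eq', mem_univ, if_true] at h
  exact h

theorem hashingSum_sum (π : Perm (Fin n)) :
    hashingSum π (fun r => ∑ t, r t) = (n.factorial : ℝ) ^ n * ∑ k : Fin n, meanRank n k := by
  have : (fun r : Fin n → ℝ => ∑ t, r t) = fun r => ∑ k, r (π k) := by
    funext r; exact (Equiv.sum_comp π r).symm
  rw [this, hashingSum_finset_sum, mul_sum]
  exact sum_congr rfl fun k _ => hashingSum_apply π k

theorem hashingSum_sum_sq (π : Perm (Fin n)) :
    hashingSum π (fun r => ∑ t, r t ^ 2) =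
      (n.factorial : ℝ) ^ n * ∑ k : Fin n, meanSqRank n k := by
  have : (fun r : Fin n → ℝ => ∑ t, r t ^ 2) = fun r => ∑ k, r (π k) ^ 2 := by
    funext r; exact (Equiv.sum_comp π fun t => r t ^ 2).symm
  rw [this, hashingSum_finset_sum, mul_sum]
  exact sum_congr rfl fun k _ => hashingSum_apply_sq π k

theorem hashingSum_sq_sum (π : Perm (Fin n)) :
    hashingSum π (fun r => (∑ t, r t) ^ 2) = (n.factorial : ℝ) ^ n *
      ((∑ k : Fin n, meanRank n k) ^ 2 - ∑ k : Fin n, meanRank n k ^ 2 +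
        ∑ k : Fin n, meanSqRank n k) := by
  have : (fun r : Fin n → ℝ => (∑ t, r t) ^ 2) = fun r => ∑ k, ∑ l, r (π k) * r (π l) := by
    funext r; rw [← Equiv.sum_comp π r, sq, sum_mul_sum]
  rw [this, hashingSum_finset_sum]
  simp only [hashingSum_finset_sum]
  -- Independence gives products off the diagonal; on it the variance is added.
  have hterm : ∀ k l : Fin n, hashingSum π (fun r => r (π k) * r (π l)) = (n.factorial : ℝ) ^ n *
      (meanRank n k * meanRank n l +
        if k = l then meanSqRank n l - meanRank n l ^ 2 else 0) := by
    intro k l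
    split_ifs with h
    · subst h
      simp only [← sq]
      rw [hashingSum_apply_sq]; ring
    · rw [hashingSum_apply_mul π h, add_zero]
  simp only [hterm, ← mul_sum, sum_add_distrib, sum_ite_eq, mem_univ, if_true, sum_sub_distrib, sq,
    sum_mul_sum]
  ring

/-- If `g` is given by stability, or by uniform hashing, then the expected value of `F` at its
ranks is `c`, provided that this holds for uniform hashing with any priorities. -/
theorem E_eq_of_hashingSum {g : Profile n → Alloc n}
    (hg : (∀ p, IsStable p (g p)) ∨ ∃ π, ∀ p, IsUniformHashing π p (g p))
    {F : (Fin n → ℝ) → ℝ} {c : ℝ} (hF : ∀ π, hashingSum π F = (n.factorial : ℝ) ^ n * c) :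
    E (fun p => F (finalRank p (g p))) = c := by
  classical
  have hne : (n.factorial : ℝ) ≠ 0 := by positivity
  rw [E, div_eq_iff (pow_ne_zero _ hne), mul_comm c]
  rcases hg with hg | ⟨π, hg⟩
  · have h := sum_isStable_eq F
    have h1 : ∀ p, ∑ g', (if IsStable p g' then F (finalRank p g') else 0) =
        F (finalRank p (g p)) := fun p =>
      sum_ite_eq_of_existsUnique (existsUnique_isStable p) (hg p) fun g' => F (finalRank p g')
    have h2 : ∀ π : Perm (Fin n), ∑ p : Profile n, ∑ g',
        (if IsUniformHashing π p g' then F (finalRank p g') else 0) = (n.factorial : ℝ) ^ n * c := hF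
    simp only [h1, h2] at h
    simpa [Fintype.card_perm, hne] using h
  · rw [← hF π, hashingSum]
    exact sum_congr rfl fun p _ => (sum_ite_eq_of_existsUnique
      (existsUnique_isUniformHashing π p) (hg p) fun g' => F (finalRank p g')).symm

/-! ### Harmonic sums -/

theorem H_succ (n : ℕ) : H (n + 1) = H n + 1 / (n + 1) := by
  rw [H, sum_Icc_succ_top (by omega), H]; push_cast; rfl

theorem H₂_succ (n : ℕ) : H₂ (n + 1) = H₂ n + 1 / ((n : ℝ) + 1) ^ 2 := by
  rw [H₂, sum_Icc_succ_top (by omega), H₂]; push_cast; rfl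

/-- Passes from the number of goods taken to the number still free. -/
theorem sum_fin_rev (f : ℝ → ℝ) (n : ℕ) :
    ∑ k : Fin n, f ((n : ℝ) - (k : ℕ)) = ∑ i ∈ range n, f (i + 1) := by
  rw [← Equiv.sum_comp Fin.revPerm, ← Fin.sum_univ_eq_sum_range (fun i => f ((i : ℝ) + 1)) n]
  refine sum_congr rfl fun k _ => ?_
  rw [Fin.revPerm_apply, Fin.val_rev, Nat.cast_sub (by omega)]
  push_cast
  congr 1
  ring

theorem sum_range_inv (n : ℕ) :
    ∑ i ∈ range n, 1 / ((i : ℝ) + 1 + 1) = H n - 1 + 1 / (n + 1) := by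
  induction n with
  | zero => simp [H]
  | succ n ih => rw [sum_range_succ, ih, H_succ]; push_cast; ring

theorem sum_range_inv_sq (n : ℕ) :
    ∑ i ∈ range n, (1 / ((i : ℝ) + 1 + 1)) ^ 2 = H₂ n - 1 + 1 / ((n : ℝ) + 1) ^ 2 := by
  induction n with
  | zero => simp [H₂]
  | succ n ih => rw [sum_range_succ, ih, H₂_succ]; push_cast; simp only [one_div, inv_pow]; ring

theorem sum_range_inv_mul (n : ℕ) :
    ∑ i ∈ range n, 1 / (((i : ℝ) + 1 + 1) * (i + 1 + 2)) = 1 / 2 - 1 / (n + 2) := by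
  induction n with
  | zero => simp
  | succ n ih =>
    have h1 : (n : ℝ) + 2 ≠ 0 := by positivity
    have h2 : (n : ℝ) + 3 ≠ 0 := by positivity
    have e1 : (n : ℝ) + 1 + 1 = n + 2 := by ring
    have e2 : (n : ℝ) + 1 + 2 = n + 3 := by ring
    rw [sum_range_succ, ih]; push_cast; rw [e1, e2]; field_simp; ring

theorem sum_meanRank (n : ℕ) : ∑ k : Fin n, meanRank n k = (n + 1) * H n - n := by
  have h1 : (n : ℝ) + 1 ≠ 0 := by positivity
  have := sum_fin_rev (fun x => ((n : ℝ) + 1) * (1 / (x + 1))) n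
  rw [← mul_sum, ← mul_sum, sum_range_inv, mul_sum] at this
  simp only [meanRank]
  calc _ = _ := sum_congr rfl fun k _ => by rw [mul_one_div]
    _ = _ := this
    _ = _ := by field_simp; ring

theorem sum_meanRank_sq (n : ℕ) :
    ∑ k : Fin n, meanRank n k ^ 2 = (n + 1) ^ 2 * H₂ n - (n + 1) ^ 2 + 1 := by
  have h1 : (n : ℝ) + 1 ≠ 0 := by positivity
  have := sum_fin_rev (fun x => ((n : ℝ) + 1) ^ 2 * (1 / (x + 1)) ^ 2) n
  rw [← mul_sum, ← mul_sum, sum_range_inv_sq, mul_sum] at this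
  simp only [meanRank]
  calc _ = _ := sum_congr rfl fun k _ => by rw [← mul_pow, mul_one_div]
    _ = _ := this
    _ = _ := by field_simp

theorem sum_meanSqRank (n : ℕ) :
    ∑ k : Fin n, meanSqRank n k = (n + 1) * (n - H n) + n := by
  have h1 : (n : ℝ) + 2 ≠ 0 := by positivity
  have := sum_fin_rev (fun x => 2 * ((n : ℝ) + 1) * (n + 2) * (1 / ((x + 1) * (x + 2)))) n
  rw [← mul_sum, ← mul_sum, sum_range_inv_mul, mul_sum] at this
  simp only [meanSqRank, sum_sub_distrib]
  have h2 := sum_meanRank n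
  simp only [meanRank] at h2
  rw [h2]
  simp only [mul_one_div] at this
  rw [this]
  field_simp
  ring

/-! ### Exact expectations and variances -/

theorem E_sub (X Y : Profile n → ℝ) : E (fun p => X p - Y p) = E X - E Y := by
  simp only [E, sum_sub_distrib, sub_div]

theorem E_const_mul (c : ℝ) (X : Profile n → ℝ) : E (fun p => c * X p) = c * E X := by
  simp only [E, ← mul_sum, mul_div_assoc]

theorem E_const (c : ℝ) : E (fun _ : Profile n => c) = c := by
  have hne : (n.factorial : ℝ) ≠ 0 := by positivity
  simp only [E, sum_const, card_univ, Fintype.card_pi, Fintype.card_perm, Fintype.card_fin,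
    prod_const, nsmul_eq_mul]
  push_cast
  field_simp

theorem Var_eq (X : Profile n → ℝ) : Var X = E (fun p => X p ^ 2) - E X ^ 2 := by
  have : (fun p => (X p - E X) ^ 2) = fun p => X p ^ 2 - (2 * E X * X p - E X ^ 2) := by
    funext p; ring
  rw [Var, this, E_sub, E_sub, E_const_mul, E_const]
  ring

theorem rankEmpVar_eq (p : Profile n) (g : Alloc n) :
    rankEmpVar p g = rankSqSum p g / n - (rankSum p g / n) ^ 2 := by
  rcases Nat.eq_zero_or_pos n with rfl | hn
  · simp [rankEmpVar]
  have hne : (n : ℝ) ≠ 0 := by positivity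
  have h : ∀ c : ℝ, ∑ k, (finalRank p g k - c) ^ 2 = rankSqSum p g - 2 * c * rankSum p g +
      n * c ^ 2 := by
    intro c
    have : ∀ k, (finalRank p g k - c) ^ 2 = finalRank p g k ^ 2 - 2 * c * finalRank p g k +
      c ^ 2 := fun k => by ring
    simp only [this, sum_add_distrib, sum_sub_distrib, ← mul_sum, rankSqSum, rankSum, sum_const,
      card_univ, Fintype.card_fin, nsmul_eq_mul]
  rw [rankEmpVar, h]
  field_simp
  ring

section Formulas

variable {g : Profile n → Alloc n}

theorem E_rankSqSum (hg : (∀ p, IsStable p (g p)) ∨ ∃ π, ∀ p, IsUniformHashing π p (g p)) :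
    E (fun p => rankSqSum p (g p)) = (n + 1) * (n - H n) + n := by
  rw [← sum_meanSqRank]
  exact E_eq_of_hashingSum hg hashingSum_sum_sq

theorem E_rankSum (hg : (∀ p, IsStable p (g p)) ∨ ∃ π, ∀ p, IsUniformHashing π p (g p)) :
    E (fun p => rankSum p (g p)) = (n + 1) * H n - n := by
  rw [← sum_meanRank]
  exact E_eq_of_hashingSum hg hashingSum_sum

theorem E_rankSum_sq (hg : (∀ p, IsStable p (g p)) ∨ ∃ π, ∀ p, IsUniformHashing π p (g p)) :
    E (fun p => rankSum p (g p) ^ 2) = (n + 1) ^ 2 * (H n ^ 2 - H₂ n)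
      - (n + 1) * (2 * n + 1) * H n + n * (3 * n + 4) := by
  have h := E_eq_of_hashingSum hg hashingSum_sq_sum
  rw [sum_meanRank, sum_meanRank_sq, sum_meanSqRank] at h
  exact h.trans (by ring)

theorem E_rankEmpVar (g : Profile n → Alloc n) :
    E (fun p => rankEmpVar p (g p)) =
      E (fun p => rankSqSum p (g p) / n) - E (fun p => (rankSum p (g p) / n) ^ 2) := by
  rw [← E_sub]
  simp only [rankEmpVar_eq]

theorem E_rankEmpVar_eq
    (hg : (∀ p, IsStable p (g p)) ∨ ∃ π, ∀ p, IsUniformHashing π p (g p)) :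
    E (fun p => rankEmpVar p (g p)) = ((n + 1) * (n - H n) + n) / n -
      ((n + 1) ^ 2 * (H n ^ 2 - H₂ n) - (n + 1) * (2 * n + 1) * H n + n * (3 * n + 4)) / n ^ 2 := by
  rw [E_rankEmpVar, ← E_rankSqSum hg, ← E_rankSum_sq hg]
  have h1 : ∀ p, rankSqSum p (g p) / n = (n : ℝ)⁻¹ * rankSqSum p (g p) := fun p => by
    rw [div_eq_inv_mul]
  have h2 : ∀ p, (rankSum p (g p) / n) ^ 2 = ((n : ℝ) ^ 2)⁻¹ * rankSum p (g p) ^ 2 := fun p => by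
    rw [div_pow, div_eq_inv_mul]
  simp only [h1, h2, E_const_mul]
  simp only [div_eq_inv_mul]

theorem Var_rankSum (hg : (∀ p, IsStable p (g p)) ∨ ∃ π, ∀ p, IsUniformHashing π p (g p)) :
    Var (fun p => rankSum p (g p)) =
      2 * n * (n + 2) - (n + 1) ^ 2 * H₂ n - (n + 1) * H n := by
  rw [Var_eq, E_rankSum_sq hg, E_rankSum hg]
  ring

end Formulas

/-! ### Asymptotic estimates -/

theorem H_nonneg (n : ℕ) : 0 ≤ H n := sum_nonneg fun _ _ => by positivity

theorem H₂_nonneg (n : ℕ) : 0 ≤ H₂ n := sum_nonneg fun _ _ => by positivity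

theorem H_le (n : ℕ) : H n ≤ 1 + Real.log n := by
  have h := harmonic_le_one_add_log n
  rw [harmonic_eq_sum_Icc] at h
  simpa [H] using h

/-- Since `1 / (m + 1) ^ 2 ≤ 1 / m - 1 / (m + 1)`, the sequence `H₂ n + 1 / n` decreases. This
bounds `H₂` and also its distance from its limit. -/
theorem H₂_add_inv_le {m n : ℕ} (hn : 1 ≤ n) (hnm : n ≤ m) :
    H₂ m + 1 / m ≤ H₂ n + 1 / n := by
  induction m, hnm using Nat.le_induction with
  | base => exact le_rfl
  | succ m hm ih =>
    refine le_trans ?_ ih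
    have hm0 : (0 : ℝ) < m := by exact_mod_cast (by omega : 0 < m)
    rw [H₂_succ]
    push_cast
    have : (1 : ℝ) / m - (1 / ((m : ℝ) + 1) ^ 2 + 1 / (m + 1)) = 1 / (m * ((m : ℝ) + 1) ^ 2) := by
      field_simp; ring
    have h2 : (0 : ℝ) ≤ 1 / (m * ((m : ℝ) + 1) ^ 2) := by positivity
    linarith

theorem H₂_le_two {n : ℕ} (hn : 1 ≤ n) : H₂ n ≤ 2 := by
  have h := H₂_add_inv_le le_rfl hn
  have h1 : H₂ 1 = 1 := by simp [H₂]
  have h2 : (0 : ℝ) ≤ 1 / n := by positivity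
  rw [h1] at h
  have h3 : (1 : ℝ) / (1 : ℕ) = 1 := by norm_num
  linarith

theorem H₂_eq_sum_range (n : ℕ) : H₂ n = ∑ k ∈ range (n + 1), 1 / (k : ℝ) ^ 2 := by
  induction n with
  | zero => simp [H₂]
  | succ n ih => rw [sum_range_succ, ← ih, H₂_succ]; push_cast; rfl

theorem H₂_le_zeta (n : ℕ) : H₂ n ≤ Real.pi ^ 2 / 6 := by
  rw [H₂_eq_sum_range]
  exact sum_le_hasSum _ (fun _ _ => by positivity) hasSum_zeta_two

theorem zeta_le_H₂_add_inv {n : ℕ} (hn : 1 ≤ n) : Real.pi ^ 2 / 6 ≤ H₂ n + 1 / n := by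
  have ht : Filter.Tendsto H₂ Filter.atTop (nhds (Real.pi ^ 2 / 6)) := by
    have := (Filter.tendsto_add_atTop_iff_nat 1).2 hasSum_zeta_two.tendsto_sum_nat
    exact this.congr fun n => (H₂_eq_sum_range n).symm
  refine le_of_tendsto ht (Filter.eventually_atTop.2 ⟨n, fun m hm => ?_⟩)
  have h := H₂_add_inv_le hn hm
  have h2 : (0 : ℝ) ≤ 1 / m := by positivity
  linarith

theorem one_le_log {n : ℕ} (hn : 3 ≤ n) : 1 ≤ Real.log n := by
  have h3 : (3 : ℝ) ≤ n := by exact_mod_cast hn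
  rw [Real.le_log_iff_exp_le (by linarith)]
  linarith [Real.exp_one_lt_d9]

theorem isBigO_empVar : (fun n : ℕ => ((n + 1) * (n - H n) + n) / n -
      ((n + 1) ^ 2 * (H n ^ 2 - H₂ n) - (n + 1) * (2 * n + 1) * H n + n * (3 * n + 4)) / n ^ 2 - n)
    =O[Filter.atTop] (fun n : ℕ => Real.log n ^ 2) := by
  refine Asymptotics.IsBigO.of_bound 60 (Filter.eventually_atTop.2 ⟨3, fun n hn => ?_⟩)
  have h3 : (3 : ℝ) ≤ n := by exact_mod_cast hn
  have hL := one_le_log hn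
  have h0 := H_nonneg n
  have h1 : H n ≤ 2 * Real.log n := by linarith [H_le n]
  have h2 := H₂_nonneg n
  have h4 := H₂_le_two (show 1 ≤ n by omega)
  have hne : (n : ℝ) ≠ 0 := by linarith
  -- In terms of `t = 1 / n` the leading `n` cancels, leaving `H n`, its square and `H₂ n` with
  -- coefficients bounded for `t ≤ 1`.
  obtain ⟨t, ht⟩ : ∃ t : ℝ, t = 1 / n := ⟨_, rfl⟩
  have ht0 : 0 ≤ t := by rw [ht]; positivity
  have ht1 : t ≤ 1 := by rw [ht, div_le_one (by linarith)]; linarith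
  have heq : ((n + 1) * (n - H n) + n) / n - (((n : ℝ) + 1) ^ 2 * (H n ^ 2 - H₂ n)
      - (n + 1) * (2 * n + 1) * H n + n * (3 * n + 4)) / n ^ 2 - n =
      (2 + (1 + t) ^ 2 * H₂ n + (1 + t) * (2 + t) * H n) -
        ((1 + t) * H n + (1 + t) ^ 2 * H n ^ 2 + 3 + 4 * t) := by
    rw [ht]; field_simp; ring
  rw [heq, Real.norm_eq_abs, Real.norm_of_nonneg (sq_nonneg _)]
  generalize Real.log n = L at *
  generalize H n = a at *
  generalize H₂ n = b at *
  have hLL : L ≤ L ^ 2 := by nlinarith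
  have haa : a ^ 2 ≤ 4 * L ^ 2 := by nlinarith
  have s1 : (1 + t) ^ 2 ≤ 4 := by nlinarith
  have s2 : (1 + t) * (2 + t) ≤ 6 := by nlinarith
  have e1 : (1 + t) ^ 2 * b ≤ 4 * 2 := mul_le_mul s1 h4 h2 (by norm_num)
  have e2 : (1 + t) * (2 + t) * a ≤ 6 * (2 * L) := mul_le_mul s2 h1 h0 (by norm_num)
  have e3 : (1 + t) * a ≤ 2 * (2 * L) := mul_le_mul (by linarith) h1 h0 (by norm_num)
  have e4 : (1 + t) ^ 2 * a ^ 2 ≤ 4 * (4 * L ^ 2) := mul_le_mul s1 haa (sq_nonneg _) (by norm_num)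
  have p1 : 0 ≤ (1 + t) ^ 2 * b := by positivity
  have p2 : 0 ≤ (1 + t) * (2 + t) * a := by positivity
  have p3 : 0 ≤ (1 + t) * a := by positivity
  have p4 : 0 ≤ (1 + t) ^ 2 * a ^ 2 := by positivity
  rw [abs_le]
  constructor <;> linarith

theorem isBigO_var : (fun n : ℕ => 2 * n * (n + 2) - (n + 1) ^ 2 * H₂ n - (n + 1) * H n
      - (2 - Real.pi ^ 2 / 6) * n ^ 2) =O[Filter.atTop] (fun n : ℕ => n * Real.log n) := by
  refine Asymptotics.IsBigO.of_bound 20 (Filter.eventually_atTop.2 ⟨3, fun n hn => ?_⟩)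
  have h3 : (3 : ℝ) ≤ n := by exact_mod_cast hn
  have hL := one_le_log hn
  have h0 := H_nonneg n
  have h1 : H n ≤ 2 * Real.log n := by linarith [H_le n]
  have h2 := H₂_nonneg n
  have h4 := H₂_le_two (show 1 ≤ n by omega)
  have hd0 : 0 ≤ Real.pi ^ 2 / 6 - H₂ n := by linarith [H₂_le_zeta n]
  have hd1 : Real.pi ^ 2 / 6 - H₂ n ≤ 1 / n := by
    linarith [zeta_le_H₂_add_inv (show 1 ≤ n by omega)]
  -- The quadratic terms collect into `n ^ 2` times the tail of the zeta series, which is at most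
  -- `n`.
  have heq : 2 * n * ((n : ℝ) + 2) - (n + 1) ^ 2 * H₂ n - (n + 1) * H n
      - (2 - Real.pi ^ 2 / 6) * n ^ 2 =
      (4 * n + n ^ 2 * (Real.pi ^ 2 / 6 - H₂ n)) - ((2 * n + 1) * H₂ n + (n + 1) * H n) := by ring
  have hnd : (n : ℝ) ^ 2 * (Real.pi ^ 2 / 6 - H₂ n) ≤ n := by
    calc _ ≤ (n : ℝ) ^ 2 * (1 / n) := by gcongr
      _ = n := by field_simp
  have hnd0 : 0 ≤ (n : ℝ) ^ 2 * (Real.pi ^ 2 / 6 - H₂ n) := by positivity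
  rw [heq, Real.norm_eq_abs, Real.norm_of_nonneg (by positivity)]
  have hnL : (n : ℝ) ≤ n * Real.log n := le_mul_of_one_le_right (by linarith) hL
  have e1 : (2 * (n : ℝ) + 1) * H₂ n ≤ 3 * n * 2 := mul_le_mul (by linarith) h4 h2 (by linarith)
  have e2 : ((n : ℝ) + 1) * H n ≤ 2 * n * (2 * Real.log n) :=
    mul_le_mul (by linarith) h1 h0 (by linarith)
  have p1 : 0 ≤ (2 * (n : ℝ) + 1) * H₂ n := by positivity
  have p2 : 0 ≤ ((n : ℝ) + 1) * H n := by positivity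
  rw [abs_le]
  constructor <;> linarith

theorem isBigO_sqrt_var :
    (fun n : ℕ => Real.sqrt (2 * n * (n + 2) - (n + 1) ^ 2 * H₂ n - (n + 1) * H n))
      =O[Filter.atTop] (fun n : ℕ => (n : ℝ)) := by
  refine Asymptotics.IsBigO.of_bound 3 (Filter.eventually_atTop.2 ⟨1, fun n hn => ?_⟩)
  have h1 : (1 : ℝ) ≤ n := by exact_mod_cast hn
  have h2 := mul_nonneg (sq_nonneg ((n : ℝ) + 1)) (H₂_nonneg n)
  have h3 : 0 ≤ ((n : ℝ) + 1) * H n := mul_nonneg (by linarith) (H_nonneg n)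
  rw [Real.norm_of_nonneg (Real.sqrt_nonneg _), Real.norm_of_nonneg (by linarith)]
  refine Real.sqrt_le_iff.2 ⟨by linarith, ?_⟩
  -- Dropping the subtracted terms leaves `2 * n * (n + 2)`, at most `(3 * n) ^ 2`.
  nlinarith

end Allocation

theorem mainTheorem5 :
    -- each profile has exactly one stable allocation, and one outcome of uniform hashing
    (∀ (n : ℕ) (p : Allocation.Profile n), ∃! g, Allocation.IsStable p g) ∧
    (∀ (n : ℕ) (π : Equiv.Perm (Fin n)) (p : Allocation.Profile n),
      ∃! g, Allocation.IsUniformHashing π p g) ∧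
    -- the formulas hold for stable allocation, and for uniform hashing with any fixed priorities
    ∀ g : (n : ℕ) → Allocation.Profile n → Allocation.Alloc n,
      ((∀ n p, Allocation.IsStable p (g n p)) ∨
        (∃ π : (n : ℕ) → Equiv.Perm (Fin n),
          ∀ n p, Allocation.IsUniformHashing (π n) p (g n p))) →
      -- second moments
      (∀ n : ℕ, Allocation.E (fun p => Allocation.rankSqSum p (g n p)) =
        (n + 1) * (n - Allocation.H n) + n) ∧
      (∀ n : ℕ, Allocation.E (fun p => Allocation.rankSum p (g n p) ^ 2) =
        (n + 1) ^ 2 * (Allocation.H n ^ 2 - Allocation.H₂ n)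
          - (n + 1) * (2 * n + 1) * Allocation.H n + n * (3 * n + 4)) ∧
      -- expected empirical variance of the ranks
      (∀ n : ℕ, Allocation.E (fun p => Allocation.rankEmpVar p (g n p)) =
        Allocation.E (fun p => Allocation.rankSqSum p (g n p) / n)
          - Allocation.E (fun p => (Allocation.rankSum p (g n p) / n) ^ 2)) ∧
      (fun n : ℕ => Allocation.E (fun p => Allocation.rankEmpVar p (g n p)) - n)
        =O[Filter.atTop] (fun n : ℕ => Real.log n ^ 2) ∧
      -- variance and standard deviation of the rank sum
      (∀ n : ℕ, Allocation.Var (fun p => Allocation.rankSum p (g n p)) =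
        Allocation.E (fun p => Allocation.rankSum p (g n p) ^ 2)
          - Allocation.E (fun p => Allocation.rankSum p (g n p)) ^ 2) ∧
      (∀ n : ℕ, Allocation.Var (fun p => Allocation.rankSum p (g n p)) =
        2 * n * (n + 2) - (n + 1) ^ 2 * Allocation.H₂ n - (n + 1) * Allocation.H n) ∧
      (fun n : ℕ => Allocation.Var (fun p => Allocation.rankSum p (g n p))
          - (2 - Real.pi ^ 2 / 6) * n ^ 2)
        =O[Filter.atTop] (fun n : ℕ => n * Real.log n) ∧
      (fun n : ℕ => Real.sqrt (Allocation.Var (fun p => Allocation.rankSum p (g n p))))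
        =O[Filter.atTop] (fun n : ℕ => (n : ℝ)) := by
  refine ⟨fun _ => Allocation.existsUnique_isStable,
    fun _ => Allocation.existsUnique_isUniformHashing, fun g hg => ?_⟩
  have hg' : ∀ n, (∀ p, Allocation.IsStable p (g n p)) ∨
      ∃ π, ∀ p, Allocation.IsUniformHashing π p (g n p) := by
    intro n
    rcases hg with h | ⟨π, h⟩
    · exact Or.inl (h n)
    · exact Or.inr ⟨π n, h n⟩
  refine ⟨fun n => Allocation.E_rankSqSum (hg' n), fun n => Allocation.E_rankSum_sq (hg' n),
    fun n => Allocation.E_rankEmpVar (g n), ?_, fun n => Allocation.Var_eq _,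
    fun n => Allocation.Var_rankSum (hg' n), ?_, ?_⟩
  · simpa only [fun n => Allocation.E_rankEmpVar_eq (hg' n)] using Allocation.isBigO_empVar
  · simpa only [fun n => Allocation.Var_rankSum (hg' n)] using Allocation.isBigO_var
  · simpa only [fun n => Allocation.Var_rankSum (hg' n)] using Allocation.isBigO_sqrt_var
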